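/- Let $X\neq\{0\}$ be a Banach space over $\mathbb K\in\{\mathbb R,\mathbb C\}$, and let $G$ be a group of surjective linear isometries of $X$ that is compact in the topology inherited from the space $\mathcal L(X)$ of bounded operators (operator norm). Let $X^*_G=\{f\in X^*: f(g(x))=f(x)\text{ for all }g\in G,\ x\in X\}$ be the space of $G$-invariant functionals, and let $NA(X)$ be the set of $f\in X^*$ for which there is $x\in X$ with $\|x\|=1$ and $f(x)=\|f\|$. Suppose that $X^*$ is $G$-strongly subdifferentiable ($G$-SSD), that is, for every $u^*\in X^*_G$ with $\|u^*\|=1$ the limit $$\lim_{t\to0^+}\frac{\|u^*+t\,x^*\|-1}{t}$$ exists uniformly for $x^*\in X^*_G$ with $\|x^*\|\le 1$. Then every $G$-invariant functional $f\in X^*_G$ attains its norm, i.e. there is $x\in X$ with $\|x\|=1$ and $f(x)=\|f\|$. Consequently $X^*_G$ is a closed linear subspace of $X^*$ that is contained in $NA(X)$. -/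

import Mathlib

open Filter Topology

namespace GroupInvariant

variable {𝕜 : Type*} [RCLike 𝕜] {X : Type*} [NormedAddCommGroup X] [NormedSpace 𝕜 X]

/-- The elements of a group `G` of surjective linear isometries of `X`, as a subset of the space
`𝓛(X)` of bounded operators, which carries the operator norm topology. -/
def operators (G : Subgroup (X ≃ₗᵢ[𝕜] X)) : Set (X →L[𝕜] X) :=
  {T | ∃ g ∈ G, ∀ x, T x = g x}

/-- The group `G` is compact in the topology inherited from `𝓛(X)`. -/
def IsCompactGroup (G : Subgroup (X ≃ₗᵢ[𝕜] X)) : Prop :=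
  IsCompact (operators G)

/-- The adjoints `T* : X* → X*`, `T* f = f ∘ T`, of the operators `T` in `Γ`. For `Γ = G` this is
the dual group `G*`. -/
def dualOperators (Γ : Set (X →L[𝕜] X)) : Set (StrongDual 𝕜 X →L[𝕜] StrongDual 𝕜 X) :=
  {S | ∃ T ∈ Γ, ∀ f : StrongDual 𝕜 X, S f = f.comp T}

/-- The subspace `X_Γ` of the points of `X` that are fixed by every operator in `Γ`. -/
def invariantPoints (Γ : Set (X →L[𝕜] X)) : Submodule 𝕜 X where
  carrier := {x | ∀ T ∈ Γ, T x = x}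
  add_mem' := by
    intro a b ha hb T hT
    rw [map_add, ha T hT, hb T hT]
  zero_mem' := by
    intro T _
    exact map_zero T
  smul_mem' := by
    intro c x hx T hT
    rw [map_smul, hx T hT]

/-- The space `X*_G` of the `G`-invariant continuous linear functionals on `X`. -/
def invariantFunctionals (G : Subgroup (X ≃ₗᵢ[𝕜] X)) : Submodule 𝕜 (StrongDual 𝕜 X) where
  carrier := {f | ∀ g ∈ G, ∀ x, f (g x) = f x}
  add_mem' := by
    intro a b ha hb g hg x
    rw [add_apply, add_apply, ha g hg x, hb g hg x]
  zero_mem' := by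
    intro g _ x
    rfl
  smul_mem' := by
    intro c f hf g hg x
    rw [smul_apply, smul_apply, hf g hg x]

/-- The norm is strongly subdifferentiable at `u` relative to `Γ`: the limit
`τ x = lim_{t → 0⁺} (‖u + t x‖ - 1) / t` exists uniformly for `x` in the closed unit ball
of `X_Γ`. -/
def IsSSDAt (Γ : Set (X →L[𝕜] X)) (u : X) : Prop :=
  ∃ τ : X → ℝ,
    TendstoUniformlyOn (fun (t : ℝ) (x : X) => (‖u + (t : 𝕜) • x‖ - 1) / t) τ (𝓝[>] (0 : ℝ))
      {x | x ∈ invariantPoints Γ ∧ ‖x‖ ≤ 1}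

/-- The space `X` is strongly subdifferentiable relative to `Γ`: this holds at every `u` in the
unit sphere of `X_Γ`. -/
def IsSSD (Γ : Set (X →L[𝕜] X)) : Prop :=
  ∀ u ∈ invariantPoints Γ, ‖u‖ = 1 → IsSSDAt Γ u

/-- `X*` is `G`-strongly subdifferentiable, `G` acting on `X*` through the dual group `G*`. -/
def DualIsGSSD (G : Subgroup (X ≃ₗᵢ[𝕜] X)) : Prop :=
  IsSSD (dualOperators (operators G))

variable (𝕜 X) in
/-- The set `NA(X)` of the functionals that attain their norm at a point of the unit sphere. -/
def NA : Set (StrongDual 𝕜 X) :=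
  {f | ∃ x : X, ‖x‖ = 1 ∧ f x = (‖f‖ : 𝕜)}

/-- The points of `X*` fixed by `G*` are the `G`-invariant functionals. -/
theorem invariantPoints_dualOperators (G : Subgroup (X ≃ₗᵢ[𝕜] X)) :
    invariantPoints (dualOperators (operators G)) = invariantFunctionals G := by
  ext f
  constructor
  · intro h g hg x
    have := h (ContinuousLinearMap.precomp 𝕜 (g.toContinuousLinearEquiv : X →L[𝕜] X))
      ⟨_, ⟨g, hg, fun _ => rfl⟩, fun _ => rfl⟩
    exact congrArg (fun f : StrongDual 𝕜 X => f x) this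
  · rintro h S ⟨T, ⟨g, hg, hT⟩, hS⟩
    ext x
    rw [hS, ContinuousLinearMap.comp_apply, hT, h g hg x]

end GroupInvariant

/-! Averaging over Haar measure gives a contractive projection `P` onto the fixed space `Y` of `G`,
with `f ∘ P = f` for invariant `f` (`exists_invariant_projection`). Hence taking real parts on `Y`
identifies the invariant functionals isometrically with the real dual of `Y`
(`norm_eq_norm_re_restrict`), and the `G`-SSD hypothesis becomes ordinary strong
subdifferentiability of that dual norm.

This reduces the claim to the case without a group, `exists_apply_eq_one_of_ssd`. By Hahn–Banach
(`exists_near_of_forall_le_norm_sub`), SSD at `f` means that every point of the ball almost norming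
`f` has, within `ε`, points norming it arbitrarily well. Iterating with summable `ε` gives a Cauchy
sequence whose limit norms `f`. -/

namespace GroupInvariant

/-! ### Norm attainment from strong subdifferentiability of the dual norm -/

/-- If `φ ≤ C` on the ball of radius `r` around `x`, then `φ x + r ‖φ‖ ≤ C`. -/
theorem apply_add_mul_norm_le {Y : Type*} [NormedAddCommGroup Y] [NormedSpace ℝ Y]
    {φ : StrongDual ℝ Y} {x : Y} {r C : ℝ} (hr : 0 < r) (h : ∀ y, ‖y - x‖ < r → φ y ≤ C) :
    φ x + r * ‖φ‖ ≤ C := by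
  have hcl : Metric.closedBall x r ⊆ {y | φ y ≤ C} := by
    rw [← closure_ball x hr.ne']
    exact closure_minimal (fun y hy ↦ h y (by simpa [dist_eq_norm] using hy))
      (isClosed_le (by fun_prop) (by fun_prop))
  have hz : ∀ z : Y, ‖z‖ = 1 → φ x + r * φ z ≤ C := fun z hz ↦ by
    simpa using hcl (show x + r • z ∈ _ by simp [norm_smul, hz, abs_of_pos hr])
  have : ‖φ‖ ≤ (C - φ x) / r := by
    refine ContinuousLinearMap.opNorm_le_of_unit_norm
      (div_nonneg (sub_nonneg.2 (h x (by simpa using hr))) hr.le) fun z hz1 ↦ ?_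
    rw [Real.norm_eq_abs, abs_le', le_div_iff₀ hr, le_div_iff₀ hr]
    have h1 := hz z hz1
    have h2 := hz (-z) (by simpa using hz1)
    rw [map_neg] at h2
    constructor <;> linarith
  rw [le_div_iff₀ hr] at this
  linarith

/-- The duality between the supremum of `f` over the points of the unit ball that are `ε`-close to
`x` and the infimum of `‖f - k‖ + k x + ε ‖k‖` over all functionals `k`. -/
theorem exists_near_of_forall_le_norm_sub {Y : Type*} [NormedAddCommGroup Y] [NormedSpace ℝ Y]
    (f : StrongDual ℝ Y) {x : Y} (hx : ‖x‖ ≤ 1) {ε δ : ℝ} (hε : 0 < ε) (hδ : 0 < δ)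
    (h : ∀ k : StrongDual ℝ Y, 1 ≤ ‖f - k‖ + k x + ε * ‖k‖) :
    ∃ y : Y, ‖y‖ ≤ 1 ∧ ‖y - x‖ ≤ ε ∧ 1 - δ ≤ f y := by
  by_contra! hno
  -- A hyperplane `(m, c)` separating the strict hypograph of `f + δ` over the open unit ball from
  -- the `ε`-ball around `x` at height 1 yields `k = -m / c`, which violates `h`.
  let A : Set (Y × ℝ) := {p | ‖p.1‖ < 1 ∧ p.2 < f p.1 + δ}
  let B : Set (Y × ℝ) := Metric.closedBall x ε ×ˢ {1}
  have hAo : IsOpen A :=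
    (isOpen_lt (f := fun p : Y × ℝ ↦ ‖p.1‖) (g := fun _ ↦ 1) (by fun_prop) (by fun_prop)).inter
      (isOpen_lt (f := fun p : Y × ℝ ↦ p.2) (g := fun p ↦ f p.1 + δ) (by fun_prop) (by fun_prop))
  have hAc : Convex ℝ A := by
    rintro ⟨y, w⟩ ⟨hy, hw⟩ ⟨y', w'⟩ ⟨hy', hw'⟩ a b ha hb hab
    simp only at hy hw hy' hw'
    refine ⟨?_, ?_⟩
    · have := (convex_ball (0 : Y) 1) (mem_ball_zero_iff.2 hy) (mem_ball_zero_iff.2 hy') ha hb hab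
      simpa using this
    · simp only [Prod.smul_mk, Prod.mk_add_mk, map_add, map_smul, smul_eq_mul]
      obtain rfl : b = 1 - a := by linarith
      rcases ha.eq_or_lt with rfl | ha
      · linarith
      · nlinarith
  have hBc : Convex ℝ B := (convex_closedBall x ε).prod (convex_singleton 1)
  have hAB : Disjoint A B := by
    rw [Set.disjoint_left]
    rintro ⟨y, w⟩ ⟨hy, hw⟩ ⟨hy', hw'⟩
    simp only [Set.mem_singleton_iff] at hy hw hy' hw'
    subst hw'
    have := hno y hy.le (by simpa [dist_eq_norm] using hy')
    linarith
  obtain ⟨H, s, hHA, hHB⟩ := geometric_hahn_banach_open hAc hAo hBc hAB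
  let m : StrongDual ℝ Y := H.comp (ContinuousLinearMap.inl ℝ Y ℝ)
  let c : ℝ := H (0, 1)
  have hH : ∀ y w, H (y, w) = m y + c * w := by
    intro y w
    have : (y, w) = (y, (0 : ℝ)) + w • ((0 : Y), (1 : ℝ)) := by simp
    rw [this, map_add, map_smul, smul_eq_mul, mul_comm]
    rfl
  have hA : ∀ y w, ‖y‖ < 1 → w < f y + δ → m y + c * w < s := fun y w hy hw ↦
    hH y w ▸ hHA (y, w) ⟨hy, hw⟩
  have hB : ∀ y, ‖y - x‖ ≤ ε → s ≤ m y + c := by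
    intro y hy
    simpa [hH] using hHB (y, 1) ⟨by simpa [dist_eq_norm] using hy, rfl⟩
  have hmx : -m x + ε * ‖m‖ ≤ c - s := by
    have := apply_add_mul_norm_le (φ := -m) hε (C := c - s) fun y hy ↦ by
      have := hB y hy.le
      simp only [neg_apply]
      linarith
    simpa using this
  -- `A` is unbounded downwards in height, so a negative `c` would make `H` unbounded above on it.
  have hc : 0 ≤ c := by
    by_contra! hc
    have h1 := hA 0 (min 0 (s / c)) (by simp) (by simpa using Or.inl hδ)
    have h2 : c * (s / c) = s := mul_div_cancel₀ s hc.ne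
    have h3 : c * (s / c) ≤ c * min 0 (s / c) :=
      mul_le_mul_of_nonpos_left (min_le_right _ _) hc.le
    simp only [map_zero, zero_add] at h1
    linarith
  have hnorm : ‖m + c • f‖ ≤ s - c * (δ / 2) := by
    have := apply_add_mul_norm_le (φ := m + c • f) (x := 0) one_pos (C := s - c * (δ / 2))
      fun y hy ↦ by
        have := hA y (f y + δ / 2) (by simpa using hy) (by linarith)
        simp only [add_apply, smul_apply, smul_eq_mul]
        linarith
    simpa using this
  have hs : 0 < s := by simpa using hA 0 0 (by simp) (by simpa using hδ)
  -- A vertical hyperplane, `c = 0`, would separate `x` from the unit ball with a margin `ε * ‖m‖ >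
  -- 0`, although `‖x‖ ≤ 1`.
  rcases hc.eq_or_lt with hc | hc
  · rw [← hc] at hnorm hmx
    have h1 : m x ≤ ‖m‖ := (le_abs_self _).trans ((m.le_opNorm_of_le hx).trans_eq (mul_one _))
    simp only [zero_smul, add_zero, zero_mul, sub_zero] at hnorm
    have h2 : 0 < ‖m‖ := by linarith [mul_nonneg hε.le (norm_nonneg m)]
    linarith [mul_pos hε h2]
  · have h1 := h (-(c⁻¹ • m))
    have h2 : ‖f - -(c⁻¹ • m)‖ = c⁻¹ * ‖m + c • f‖ := by
      have : f - -(c⁻¹ • m) = c⁻¹ • (m + c • f) := by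
        rw [smul_add, inv_smul_smul₀ hc.ne']; abel
      rw [this, norm_smul, Real.norm_eq_abs, abs_of_pos (inv_pos.2 hc)]
    rw [h2, norm_neg, norm_smul, Real.norm_eq_abs, abs_of_pos (inv_pos.2 hc)] at h1
    simp only [neg_apply, smul_apply, smul_eq_mul] at h1
    have h3 := mul_le_mul_of_nonneg_left h1 hc.le
    have h4 : c * (c⁻¹ * ‖m + c • f‖ + -(c⁻¹ * m x) + ε * (c⁻¹ * ‖m‖)) =
        ‖m + c • f‖ - m x + ε * ‖m‖ := by field_simp; ring
    rw [h4] at h3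
    nlinarith [mul_pos hc hδ]

/-- A functional of norm one at which the dual norm is strongly subdifferentiable attains its norm.
The hypothesis is a quantitative form of strong subdifferentiability. -/
theorem exists_apply_eq_one_of_ssd {Y : Type*} [NormedAddCommGroup Y] [NormedSpace ℝ Y]
    [CompleteSpace Y] {f : StrongDual ℝ Y} (hf : ‖f‖ = 1)
    (hS : ∀ ε > 0, ∃ t > 0, ∀ h : StrongDual ℝ Y, ‖h‖ = 1 → ∀ s > 0,
      1 + s * ((‖f + t • h‖ - 1) / t - ε) ≤ ‖f + s • h‖) :
    ∃ y : Y, ‖y‖ ≤ 1 ∧ f y = 1 := by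
  have key : ∀ ε > 0, ∃ δ > 0, ∀ x : Y, ‖x‖ ≤ 1 → 1 - δ ≤ f x → ∀ δ' > 0,
      ∃ y : Y, ‖y‖ ≤ 1 ∧ ‖y - x‖ ≤ ε ∧ 1 - δ' ≤ f y := by
    intro ε hε
    obtain ⟨t, ht, hS⟩ := hS (ε / 2) (half_pos hε)
    -- Almost norming up to `t * (ε / 2)` costs `ε / 2` in the difference quotient at `t`; the SSD
    -- error is the other `ε / 2`.
    refine ⟨t * (ε / 2), by positivity, fun x hx hfx δ' hδ' ↦
      exists_near_of_forall_le_norm_sub f hx hε hδ' fun k ↦ ?_⟩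
    rcases eq_or_ne k 0 with rfl | hk
    · simp [hf]
    have hk' : 0 < ‖k‖ := norm_pos_iff.2 hk
    have h1 := hS (-(‖k‖⁻¹ • k)) (by simp [norm_smul, hk]) ‖k‖ hk'
    rw [smul_neg ‖k‖, smul_inv_smul₀ hk'.ne', ← sub_eq_add_neg f k] at h1
    have h2 : f x - t * (‖k‖⁻¹ * k x) ≤ ‖f + t • -(‖k‖⁻¹ • k)‖ := by
      have := (le_abs_self _).trans ((f + t • -(‖k‖⁻¹ • k)).le_opNorm_of_le hx)
      simpa [sub_eq_add_neg] using this
    have h3 : -(ε / 2) - ‖k‖⁻¹ * k x ≤ (‖f + t • -(‖k‖⁻¹ • k)‖ - 1) / t := by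
      rw [le_div_iff₀ ht]
      linarith
    have h4 : ‖k‖ * (-(ε / 2) - ‖k‖⁻¹ * k x - ε / 2) = -(ε * ‖k‖) - k x := by
      field_simp
      ring
    have h5 := mul_le_mul_of_nonneg_left (sub_le_sub_right h3 (ε / 2)) hk'.le
    linarith
  choose! δ hδ hδy using key
  have hpos : ∀ n : ℕ, (0 : ℝ) < (1 / 2) ^ n := fun n ↦ by positivity
  -- The first bound permits a next step of length at most `(1 / 2) ^ n`; the second forces `f (u
  -- n)` to tend to 1.
  let η : ℕ → ℝ := fun n ↦ min (δ ((1 / 2) ^ n)) ((1 / 2) ^ n)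
  have hη : ∀ n, 0 < η n := fun n ↦ lt_min (hδ _ (hpos n)) (hpos n)
  have hstep : ∀ (n : ℕ) (x : Y), ‖x‖ ≤ 1 ∧ 1 - η n ≤ f x →
      ∃ y : Y, (‖y‖ ≤ 1 ∧ 1 - η (n + 1) ≤ f y) ∧ ‖y - x‖ ≤ (1 / 2) ^ n := by
    rintro n x ⟨hx, hfx⟩
    obtain ⟨y, h1, h2, h3⟩ := hδy _ (hpos n) x hx
      (by linarith [min_le_left (δ ((1 / 2) ^ n)) ((1 / 2) ^ n)]) _ (hη (n + 1))
    exact ⟨y, ⟨h1, h3⟩, h2⟩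
  obtain ⟨x₀, hx₀⟩ : ∃ x : Y, ‖x‖ ≤ 1 ∧ 1 - η 0 ≤ f x := by
    by_contra! hno
    have := apply_add_mul_norm_le (φ := f) (x := 0) one_pos (C := 1 - η 0) fun y hy ↦
      (hno y (by simpa using hy.le)).le
    rw [hf, map_zero] at this
    linarith [hη 0]
  choose! F hF hFd using hstep
  let u : ℕ → Y := fun n ↦ Nat.rec x₀ (fun n x ↦ F n x) n
  have hu : ∀ n, ‖u n‖ ≤ 1 ∧ 1 - η n ≤ f (u n) := by
    intro n
    induction n with
    | zero => exact hx₀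
    | succ n ih => exact hF n _ ih
  have hcau : CauchySeq u := by
    refine cauchySeq_of_le_geometric (1 / 2) 1 (by norm_num) fun n ↦ ?_
    rw [dist_comm, dist_eq_norm, one_mul]
    exact hFd n _ (hu n)
  obtain ⟨y, hy⟩ := cauchySeq_tendsto_of_complete hcau
  have hy1 : ‖y‖ ≤ 1 := le_of_tendsto' hy.norm fun n ↦ (hu n).1
  refine ⟨y, hy1, le_antisymm ?_ ?_⟩
  · simpa [hf] using (le_abs_self _).trans (f.le_opNorm_of_le hy1)
  · have h1 : Tendsto (fun n : ℕ ↦ 1 - (1 / 2 : ℝ) ^ n) atTop (𝓝 (1 - 0)) :=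
      tendsto_const_nhds.sub (tendsto_pow_atTop_nhds_zero_of_lt_one (by norm_num) (by norm_num))
    rw [sub_zero] at h1
    refine le_of_tendsto_of_tendsto' h1 ((f.continuous.tendsto y).comp hy) fun n ↦ ?_
    have := (hu n).2
    have h2 : η n ≤ (1 / 2) ^ n := min_le_right _ _
    simp only [Function.comp_apply]
    linarith

/-! ### Haar averaging and the invariant projection -/

open MeasureTheory Measure

/-- The normalized Haar measure of a compact group is right invariant. -/
theorem isMulRightInvariant_of_isHaarMeasure {G : Type*} [Group G] [TopologicalSpace G]
    [IsTopologicalGroup G] [CompactSpace G] [MeasurableSpace G] [BorelSpace G] (μ : Measure G)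
    [IsHaarMeasure μ] [IsProbabilityMeasure μ] : μ.IsMulRightInvariant := by
  refine ⟨fun g ↦ ?_⟩
  have : IsProbabilityMeasure (μ.map (· * g)) :=
    isProbabilityMeasure_map (measurable_mul_const g).aemeasurable
  exact isHaarMeasure_eq_of_isProbabilityMeasure _ _

/-- Averaging a continuous isometric representation of a compact group over its Haar measure. -/
theorem exists_average {𝕜 : Type*} [RCLike 𝕜] {X : Type*} [NormedAddCommGroup X] [NormedSpace 𝕜 X]
    [CompleteSpace X] {G : Type*} [Group G] [TopologicalSpace G] [IsTopologicalGroup G]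
    [CompactSpace G] (Φ : G →* (X →L[𝕜] X)) (hΦ : Continuous Φ) (hnorm : ∀ g, ‖Φ g‖ ≤ 1) :
    ∃ P : X →L[𝕜] X, ‖P‖ ≤ 1 ∧ (∀ g, Φ g * P = P) ∧ (∀ g, P * Φ g = P) ∧
      (∀ x, (∀ g, Φ g x = x) → P x = x) ∧
      ∀ f : StrongDual 𝕜 X, (∀ g x, f (Φ g x) = f x) → ∀ x, f (P x) = f x := by
  borelize G
  let μ : Measure G := haarMeasure ⊤
  have : IsProbabilityMeasure μ := ⟨haarMeasure_self (K₀ := ⊤)⟩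
  have := isMulRightInvariant_of_isHaarMeasure μ
  let : NormedSpace ℝ (X →L[𝕜] X) := NormedSpace.restrictScalars ℝ 𝕜 (X →L[𝕜] X)
  have hint : Integrable Φ μ :=
    hΦ.integrable_of_hasCompactSupport (HasCompactSupport.of_compactSpace _)
  refine ⟨∫ g, Φ g ∂μ, ?_, fun g ↦ ?_, fun g ↦ ?_, fun x hx ↦ ?_, fun f hf x ↦ ?_⟩
  · simpa using norm_integral_le_of_norm_le_const (μ := μ) (Eventually.of_forall hnorm)
  · have h := (ContinuousLinearMap.mul 𝕜 (X →L[𝕜] X) (Φ g)).integral_comp_comm hint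
    simp only [ContinuousLinearMap.mul_apply', ← map_mul] at h
    rw [← h, integral_mul_left_eq_self (fun x ↦ Φ x)]
  · have h := ((ContinuousLinearMap.mul 𝕜 (X →L[𝕜] X)).flip (Φ g)).integral_comp_comm hint
    simp only [ContinuousLinearMap.flip_apply, ContinuousLinearMap.mul_apply', ← map_mul] at h
    rw [← h, integral_mul_right_eq_self (fun x ↦ Φ x)]
  · let : NormedSpace ℝ X := NormedSpace.restrictScalars ℝ 𝕜 X
    have h := (ContinuousLinearMap.apply 𝕜 X x).integral_comp_comm hint
    simp only [ContinuousLinearMap.apply_apply, hx] at h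
    rw [← h, integral_const]
    simp
  · have h := (f.comp (ContinuousLinearMap.apply 𝕜 X x)).integral_comp_comm hint
    simp only [ContinuousLinearMap.comp_apply, ContinuousLinearMap.apply_apply, hf] at h
    rw [← h, integral_const]
    simp

variable {𝕜 : Type*} [RCLike 𝕜] {X : Type*} [NormedAddCommGroup X] [NormedSpace 𝕜 X]

/-- The inclusion of a group of isometries into the bounded operators. -/
def toOperator (G : Subgroup (X ≃ₗᵢ[𝕜] X)) : G →* (X →L[𝕜] X) where
  toFun g := (g : X ≃ₗᵢ[𝕜] X).toContinuousLinearEquiv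
  map_one' := rfl
  map_mul' _ _ := rfl

@[simp]
theorem toOperator_apply (G : Subgroup (X ≃ₗᵢ[𝕜] X)) (g : G) (x : X) :
    toOperator G g x = (g : X ≃ₗᵢ[𝕜] X) x := rfl

theorem norm_toOperator_le (G : Subgroup (X ≃ₗᵢ[𝕜] X)) (g : G) : ‖toOperator G g‖ ≤ 1 :=
  ContinuousLinearMap.opNorm_le_bound _ zero_le_one fun x ↦ by simp

theorem range_toOperator (G : Subgroup (X ≃ₗᵢ[𝕜] X)) : Set.range (toOperator G) = operators G := by
  ext T
  constructor
  · rintro ⟨g, rfl⟩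
    exact ⟨g, g.2, fun _ ↦ rfl⟩
  · rintro ⟨g, hg, hT⟩
    exact ⟨⟨g, hg⟩, ContinuousLinearMap.ext fun x ↦ (hT x).symm⟩

/-- By `g⁻¹ - h⁻¹ = g⁻¹ (h - g) h⁻¹` and contractivity; this makes inversion continuous for the
operator norm. -/
theorem norm_toOperator_inv_sub_le (G : Subgroup (X ≃ₗᵢ[𝕜] X)) (g h : G) :
    ‖toOperator G g⁻¹ - toOperator G h⁻¹‖ ≤ ‖toOperator G g - toOperator G h‖ := by
  have : toOperator G g⁻¹ - toOperator G h⁻¹ =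
      toOperator G g⁻¹ * (toOperator G h - toOperator G g) * toOperator G h⁻¹ := by
    rw [mul_sub, sub_mul, mul_assoc, ← map_mul, ← map_mul, ← map_mul, ← map_mul]
    simp
  rw [this, norm_sub_rev (toOperator G g)]
  calc _ ≤ ‖toOperator G g⁻¹‖ * ‖toOperator G h - toOperator G g‖ * ‖toOperator G h⁻¹‖ :=
        (norm_mul_le _ _).trans (by gcongr; exact norm_mul_le _ _)
    _ ≤ 1 * ‖toOperator G h - toOperator G g‖ * 1 := by
        gcongr <;> exact norm_toOperator_le G _
    _ = _ := by ring

/-- The norm-one projection onto the fixed points of a compact group of isometries. -/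
theorem exists_invariant_projection [CompleteSpace X] (G : Subgroup (X ≃ₗᵢ[𝕜] X))
    (hG : IsCompactGroup G) :
    ∃ P : X →L[𝕜] X, ‖P‖ ≤ 1 ∧ (∀ x, P x ∈ invariantPoints (operators G)) ∧
      (∀ g ∈ G, ∀ x, P (g x) = P x) ∧ (∀ x ∈ invariantPoints (operators G), P x = x) ∧
      ∀ f ∈ invariantFunctionals G, ∀ x, f (P x) = f x := by
  let : TopologicalSpace G := TopologicalSpace.induced (toOperator G) inferInstance
  have hind : IsInducing (toOperator G) := ⟨rfl⟩
  have hcont : Continuous (toOperator G) := hind.continuous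
  have : CompactSpace G := by
    refine ⟨hind.isCompact_iff.2 ?_⟩
    rwa [Set.image_univ, range_toOperator]
  have : IsTopologicalGroup G :=
    { continuous_mul := by
        rw [hind.continuous_iff]
        simp only [Function.comp_def, map_mul]
        fun_prop
      continuous_inv := by
        rw [hind.continuous_iff, continuous_iff_continuousAt]
        intro h
        rw [ContinuousAt, tendsto_iff_norm_sub_tendsto_zero]
        refine squeeze_zero (fun _ ↦ norm_nonneg _) (fun g ↦ norm_toOperator_inv_sub_le G g h) ?_
        exact tendsto_iff_norm_sub_tendsto_zero.1 (hcont.tendsto h) }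
  obtain ⟨P, h1, h2, h3, h5, h4⟩ := exists_average (toOperator G) hcont (norm_toOperator_le G)
  refine ⟨P, h1, ?_, fun g hg x ↦ ?_,
    fun x hx ↦ h5 x fun g ↦ hx _ ⟨g, g.2, fun _ ↦ rfl⟩, fun f hf x ↦ h4 f (fun g x ↦ hf g g.2 x) x⟩
  · rintro x T ⟨g, hg, hT⟩
    rw [hT]
    exact congrArg (fun S : X →L[𝕜] X ↦ S x) (h2 ⟨g, hg⟩)
  · exact congrArg (fun S : X →L[𝕜] X ↦ S x) (h3 ⟨g, hg⟩)

/-! ### Transfer to the dual of the fixed space -/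

/-- Strong subdifferentiability in quantitative form. -/
theorem IsSSDAt.exists_le_norm_add_smul {Γ : Set (X →L[𝕜] X)} {u : X} (hu : ‖u‖ = 1)
    (h : IsSSDAt Γ u) {ε : ℝ} (hε : 0 < ε) :
    ∃ t > (0 : ℝ), ∀ x ∈ invariantPoints Γ, ‖x‖ ≤ 1 → ∀ s > (0 : ℝ),
      1 + s * ((‖u + (t : 𝕜) • x‖ - 1) / t - ε) ≤ ‖u + (s : 𝕜) • x‖ := by
  obtain ⟨τ, hτ⟩ := h
  obtain ⟨t, ht, ht0⟩ :=
    ((Metric.tendstoUniformlyOn_iff.1 hτ ε hε).and self_mem_nhdsWithin).exists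
  refine ⟨t, ht0, fun x hx hx1 s hs ↦ ?_⟩
  have h1 := (abs_lt.1 (ht x ⟨hx, hx1⟩)).1
  have h2 : τ x ≤ (‖u + (s : 𝕜) • x‖ - 1) / s := by
    refine le_of_tendsto (hτ.tendsto_at ⟨hx, hx1⟩) ?_
    filter_upwards [Ioo_mem_nhdsGT hs] with r hr
    obtain ⟨hr0, hrs⟩ := hr
    have hq : 0 ≤ 1 - r / s := sub_nonneg.2 ((div_le_one hs).2 hrs.le)
    -- By convexity of the norm the difference quotient at `r < s` is at most the one at `s`, so its
    -- limit `τ x` is too.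
    have hdec : u + (r : 𝕜) • x =
        ((1 - r / s : ℝ) : 𝕜) • u + ((r / s : ℝ) : 𝕜) • (u + (s : 𝕜) • x) := by
      rw [smul_add, smul_smul, ← RCLike.ofReal_mul, div_mul_cancel₀ r hs.ne', ← add_assoc,
        ← add_smul, ← RCLike.ofReal_add, sub_add_cancel, RCLike.ofReal_one, one_smul]
    have hle : ‖u + (r : 𝕜) • x‖ ≤ (1 - r / s) + r / s * ‖u + (s : 𝕜) • x‖ := by
      rw [hdec]
      refine (norm_add_le _ _).trans_eq ?_
      rw [norm_smul, norm_smul, RCLike.norm_ofReal, RCLike.norm_ofReal, abs_of_nonneg hq,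
        abs_of_nonneg (by positivity), hu, mul_one]
    rw [div_le_iff₀ hr0]
    calc _ ≤ r / s * ‖u + (s : 𝕜) • x‖ - r / s := by linarith
      _ = _ := by ring
  rw [le_div_iff₀ hs] at h2
  have : (‖u + (t : 𝕜) • x‖ - 1) / t - ε ≤ τ x := by linarith
  nlinarith

/-- If `P` is a contraction into `Y` that leaves `F` unchanged, then `F` has the same norm as the
real part of its restriction to `Y`. -/
theorem norm_eq_norm_re_restrict {Y : Submodule 𝕜 X} [NormedSpace ℝ Y] {P : X →L[𝕜] X}
    (hP : ‖P‖ ≤ 1) (hPY : ∀ x, P x ∈ Y) {F : StrongDual 𝕜 X} (hF : ∀ x, F (P x) = F x)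
    {φ : StrongDual ℝ Y} (hφ : ∀ y : Y, φ y = RCLike.re (F y)) : ‖φ‖ = ‖F‖ := by
  refine le_antisymm ?_ ?_
  · refine φ.opNorm_le_bound (norm_nonneg _) fun y ↦ ?_
    rw [hφ]
    exact (RCLike.norm_re_le_norm _).trans (F.le_opNorm _)
  · refine F.opNorm_le_bound (norm_nonneg _) fun x ↦ ?_
    -- Rotating `x` by a unimodular scalar makes `F x` real and nonnegative, so passing to real
    -- parts loses no norm.
    obtain ⟨c, hc, hcx⟩ := RCLike.exists_norm_eq_mul_self (F x)
    have h1 : φ ⟨P (c • x), hPY _⟩ = ‖F x‖ := by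
      rw [hφ, hF, map_smul, smul_eq_mul, ← hcx, RCLike.ofReal_re]
    rw [← h1]
    refine (le_abs_self _).trans (φ.le_opNorm_of_le ?_)
    simpa [norm_smul, hc] using P.le_of_opNorm_le hP (c • x)

theorem isClosed_invariantPoints (Γ : Set (X →L[𝕜] X)) :
    IsClosed (invariantPoints Γ : Set X) := by
  have : (invariantPoints Γ : Set X) = ⋂ T ∈ Γ, {x | T x = x} := by
    ext x
    simp [invariantPoints]
  rw [this]
  exact isClosed_biInter fun T _ ↦ isClosed_eq (by fun_prop) (by fun_prop)

/-- If the dual norm is strongly subdifferentiable at an invariant functional of norm one, then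
that functional attains its norm. -/
theorem exists_apply_eq_one [CompleteSpace X] {G : Subgroup (X ≃ₗᵢ[𝕜] X)} (hG : IsCompactGroup G)
    {u : StrongDual 𝕜 X} (hu : u ∈ invariantFunctionals G) (hu1 : ‖u‖ = 1)
    (hS : IsSSDAt (dualOperators (operators G)) u) : ∃ x : X, ‖x‖ = 1 ∧ u x = 1 := by
  obtain ⟨P, hP, hPY, hPg, hPy, hPf⟩ := exists_invariant_projection G hG
  let Y := invariantPoints (operators G)
  have : CompleteSpace Y := (isClosed_invariantPoints (operators G)).completeSpace_coe
  let : NormedSpace ℝ Y := NormedSpace.restrictScalars ℝ 𝕜 Y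
  have : IsScalarTower ℝ 𝕜 Y := .of_algebraMap_smul fun _ _ ↦ rfl
  have hnorm : ∀ F ∈ invariantFunctionals G, ∀ φ : StrongDual ℝ Y,
      (∀ y : Y, φ y = RCLike.re (F y)) → ‖φ‖ = ‖F‖ := fun F hF φ hφ ↦
    norm_eq_norm_re_restrict hP hPY (hPf F hF) hφ
  let f : StrongDual ℝ Y := RCLike.reCLM.comp ((u.comp Y.subtypeL).restrictScalars ℝ)
  have hfu : ∀ y : Y, f y = RCLike.re (u y) := fun y ↦ rfl
  have hf1 : ‖f‖ = 1 := by rw [hnorm u hu f hfu, hu1]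
  obtain ⟨y, hy, hfy⟩ := exists_apply_eq_one_of_ssd hf1 fun ε hε ↦ by
    obtain ⟨t, ht, hS⟩ := hS.exists_le_norm_add_smul hu1 hε
    refine ⟨t, ht, fun h hh s hs ↦ ?_⟩
    -- The inverse of restriction: recover the `𝕜`-linear functional from its real part, then
    -- compose with `P`, which absorbs `G`.
    let H : StrongDual 𝕜 X := (h.extendRCLike (𝕜 := 𝕜)).comp (P.codRestrict Y hPY)
    have hH : H ∈ invariantFunctionals G := fun g hg x ↦ by
      have : P.codRestrict Y hPY (g x) = P.codRestrict Y hPY x := Subtype.ext (hPg g hg x)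
      simp only [H, ContinuousLinearMap.comp_apply, this]
    have hhH : ∀ y : Y, h y = RCLike.re (H y) := fun y ↦ by
      have : P.codRestrict Y hPY y = y := Subtype.ext (hPy y y.2)
      simp only [H, ContinuousLinearMap.comp_apply, this, StrongDual.re_extendRCLike_apply]
    have hadd : ∀ r : ℝ, ‖f + r • h‖ = ‖u + (r : 𝕜) • H‖ := fun r ↦
      hnorm _ (add_mem hu (Submodule.smul_mem _ _ hH)) _ fun y ↦ by
        simp [hfu, hhH, RCLike.smul_re]
    rw [hadd, hadd]
    refine hS H ?_ ?_ s hs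
    · rwa [invariantPoints_dualOperators]
    · rw [← hnorm H hH h hhH, hh]
  have hre : RCLike.re (u y) = 1 := hfy
  have hle : ‖u y‖ ≤ ‖(y : X)‖ := by simpa [hu1] using u.le_opNorm y
  have hge : 1 ≤ ‖u y‖ := hre ▸ RCLike.re_le_norm (u y)
  refine ⟨y, le_antisymm hy (hge.trans hle), ?_⟩
  have h1 : ‖u y‖ = 1 := le_antisymm (hle.trans hy) hge
  have him : RCLike.im (u y) = 0 := by
    have := RCLike.norm_sq_eq_def (z := u y)
    rw [h1, hre] at this
    exact pow_eq_zero_iff two_ne_zero |>.1 (by linarith)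
  exact RCLike.ext (by simp [hre]) (by simp [him])

end GroupInvariant

open GroupInvariant in
theorem mainTheorem2 {𝕜 : Type*} [RCLike 𝕜] {X : Type*} [NormedAddCommGroup X]
    [NormedSpace 𝕜 X] [CompleteSpace X] [Nontrivial X]
    (G : Subgroup (X ≃ₗᵢ[𝕜] X)) (hG : GroupInvariant.IsCompactGroup G)
    (hSSD : GroupInvariant.DualIsGSSD G) :
    (∀ f : StrongDual 𝕜 X, (∀ g ∈ G, ∀ x, f (g x) = f x) →
        ∃ x : X, ‖x‖ = 1 ∧ f x = (‖f‖ : 𝕜)) ∧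
      IsClosed (GroupInvariant.invariantFunctionals G : Set (StrongDual 𝕜 X)) ∧
      (GroupInvariant.invariantFunctionals G : Set (StrongDual 𝕜 X)) ⊆
        GroupInvariant.NA 𝕜 X := by
  have hna : ∀ f ∈ invariantFunctionals G, ∃ x : X, ‖x‖ = 1 ∧ f x = (‖f‖ : 𝕜) := by
    intro f hf
    rcases eq_or_ne f 0 with rfl | hf0
    · let : NormedSpace ℝ X := NormedSpace.restrictScalars ℝ 𝕜 X
      obtain ⟨x, hx⟩ := exists_norm_eq X zero_le_one
      exact ⟨x, hx, by simp⟩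
    have hn : (‖f‖ : 𝕜) ≠ 0 := by simpa using hf0
    have hu : (‖f‖ : 𝕜)⁻¹ • f ∈ invariantFunctionals G := Submodule.smul_mem _ _ hf
    have hu1 : ‖(‖f‖ : 𝕜)⁻¹ • f‖ = 1 := by simp [norm_smul, hf0]
    obtain ⟨x, hx, hfx⟩ := exists_apply_eq_one hG hu hu1
      (hSSD _ (by rwa [invariantPoints_dualOperators]) hu1)
    refine ⟨x, hx, ?_⟩
    rwa [smul_apply, smul_eq_mul, inv_mul_eq_one₀ hn, eq_comm] at hfx
  refine ⟨hna, ?_, hna⟩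
  rw [← invariantPoints_dualOperators]
  exact isClosed_invariantPoints _
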